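/- Let $B_{1,n}$ be the Artin braid group of type B, with generators $t,\sigma_1,\dots,\sigma_{n-1}$ and relations $\sigma_1t\sigma_1t=t\sigma_1t\sigma_1$, $t\sigma_i=\sigma_it$ for $i>1$, $\sigma_i\sigma_{i+1}\sigma_i=\sigma_{i+1}\sigma_i\sigma_{i+1}$, and $\sigma_i\sigma_j=\sigma_j\sigma_i$ for $|i-j|>1$. Let $H_{1,n}(q)=\mathbb C[q^{\pm1}]B_{1,n}/\langle\sigma_i^2-(q-1)\sigma_i-q\rangle$, let $t_0=t$ and $t_i=\sigma_i\cdots\sigma_1t\,\sigma_1\cdots\sigma_i$. For $x,y\in H_{1,n}(q)$ write $x\mathrel{\widehat=}y$ (equality up to conjugation) if $x-y$ lies in the $\mathbb C[q^{\pm1}]$-linear span of the elements $\beta^{-1}a\beta-a$ with $\beta\in B_{1,n}$, $a\in H_{1,n}(q)$. Let $m\ge 0$, $n\ge m+2$, let $k_0,\dots,k_m\ge 1$ be integers, let $\epsilon_0,\dots,\epsilon_m\in\{1,-1\}$ and $\delta\in\{1,-1\}$. Put $$D_i=\sigma_i^{\epsilon_{i-1}}\cdots\sigma_2^{\epsilon_1}\sigma_1^{\epsilon_0},\qquad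 A_i=\sigma_1^{\epsilon_0}\sigma_2^{\epsilon_1}\cdots\sigma_i^{\epsilon_{i-1}}\qquad(D_0=A_0=1).$$ Then in $H_{1,n}(q)$ $$ \begin{aligned} t_1^{\epsilon_0k_0}t_2^{\epsilon_1k_1}\cdots t_{m+1}^{\epsilon_mk_m}\,\sigma_1^{\delta}\ \mathrel{\widehat=}\ {}& q^{\sum_{i=0}^m\epsilon_i(k_i-1)}\;t_0^{\epsilon_0k_0}t_1^{\epsilon_1k_1}\cdots t_m^{\epsilon_mk_m}\;D_{m+1}\,\sigma_1^{\delta}\,A_{m+1}\\ &+\sum_{i=0}^{m}\sum_{u=1}^{k_i-1}q^{\sum_{j<i}\epsilon_j(k_j-1)+\epsilon_i(u-1)}\,(q^{\epsilon_i}-1)\;t_0^{\epsilon_0k_0}\cdots t_{i-1}^{\epsilon_{i-1}k_{i-1}}\;t_i^{\epsilon_iu}\,t_{i+1}^{\epsilon_i(k_i-u)}\;t_{i+2}^{\epsilon_{i+1}k_{i+1}}\cdots t_{m+1}^{\epsilon_mk_m}\;D_i\,\sigma_1^{\delta}\,A_{i+1}. \end{aligned} $$ In particular, for $\delta=1$ and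 all $\epsilon_i=1$, with $\tau_{a,b}^{k}$ denoting the corresponding monomials in consecutive $t_i$'s, $$ \begin{aligned} \tau_{1,m+1}^{k_{0,m}}\,\sigma_1\ \mathrel{\widehat=}\ {}& q^{\sum_{i=0}^mk_i-(m+1)}\;\tau_{0,m}^{k_{0,m}}\;\sigma_{m+1}\cdots\sigma_2\,\sigma_1^{3}\,\sigma_2\cdots\sigma_{m+1}\\ &+\sum_{i=0}^{m}\sum_{u=1}^{k_i-1}q^{u+\sum_{j=0}^{i-1}k_j-(i+1)}(q-1)\;\tau_{0,i-1}^{k_{0,i-1}}\,t_i^{u}\,t_{i+1}^{k_i-u}\,\tau_{i+2,m+1}^{k_{i+1,m}}\;w_i, \end{aligned} $$ where $w_0=\sigma_1^2$ and $w_i=\sigma_i\cdots\sigma_2\,\sigma_1^3\,\sigma_2\cdots\sigma_{i+1}$ for $i\ge1$. -/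

import Mathlib

/-- Generators of the Artin braid group of type B on `n` moving strands: the loop `t` and
`n - 1` crossings; `crossing j` stands for `σ_{j+1}`. -/
inductive ArtinBGen (n : ℕ) : Type
  | loop : ArtinBGen n
  | crossing (j : Fin (n - 1)) : ArtinBGen n

/-- The defining relators of the Artin braid group of type B. -/
inductive ArtinBRelator (n : ℕ) : FreeGroup (ArtinBGen n) → Prop
  /-- `σ₁ t σ₁ t = t σ₁ t σ₁` -/
  | fourBraid (i : Fin (n - 1)) (hi : i.val = 0) :
      ArtinBRelator n
        (FreeGroup.of (.crossing i) * FreeGroup.of .loop *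
            FreeGroup.of (.crossing i) * FreeGroup.of .loop *
          (FreeGroup.of .loop * FreeGroup.of (.crossing i) *
            FreeGroup.of .loop * FreeGroup.of (.crossing i))⁻¹)
  /-- `t σ_i = σ_i t` for `i > 1` -/
  | loopComm (i : Fin (n - 1)) (hi : 0 < i.val) :
      ArtinBRelator n
        (FreeGroup.of .loop * FreeGroup.of (.crossing i) *
          (FreeGroup.of (.crossing i) * FreeGroup.of .loop)⁻¹)
  /-- `σ_i σ_{i+1} σ_i = σ_{i+1} σ_i σ_{i+1}` -/
  | braid (i j : Fin (n - 1)) (hij : j.val = i.val + 1) :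
      ArtinBRelator n
        (FreeGroup.of (.crossing i) * FreeGroup.of (.crossing j) * FreeGroup.of (.crossing i) *
          (FreeGroup.of (.crossing j) * FreeGroup.of (.crossing i) *
            FreeGroup.of (.crossing j))⁻¹)
  /-- `σ_i σ_j = σ_j σ_i` for `|i - j| > 1` -/
  | farComm (i j : Fin (n - 1)) (hij : i.val + 1 < j.val) :
      ArtinBRelator n
        (FreeGroup.of (.crossing i) * FreeGroup.of (.crossing j) *
          (FreeGroup.of (.crossing j) * FreeGroup.of (.crossing i))⁻¹)

/-- The Artin braid group of type B, `B_{1,n}`: mixed braids with `n` moving strands. -/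
abbrev BraidB (n : ℕ) : Type := PresentedGroup {r | ArtinBRelator n r}

/-- The generator `t` of `B_{1,n}`. -/
def braidT (n : ℕ) : BraidB n := PresentedGroup.of ArtinBGen.loop

/-- The generator `σ_i` of `B_{1,n}`, for `1 ≤ i ≤ n - 1` (and `1` for the other `i`, which are
never used). -/
def braidSigma (n i : ℕ) : BraidB n :=
  if h : 1 ≤ i ∧ i ≤ n - 1 then
    PresentedGroup.of (ArtinBGen.crossing ⟨i - 1, by omega⟩)
  else 1

/-- The looping elements `t_0 = t`, `t_i = σ_i ⋯ σ_1 t σ_1 ⋯ σ_i`. -/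
def looping (n : ℕ) : ℕ → BraidB n
  | 0 => braidT n
  | i + 1 => braidSigma n (i + 1) * looping n i * braidSigma n (i + 1)

/-- The gap-free monomial `t_a^{e 0} t_{a+1}^{e 1} ⋯ t_{a+l-1}^{e (l-1)}` (with `l` factors). -/
def loopMonomial (n a l : ℕ) (e : ℕ → ℤ) : BraidB n :=
  ((List.range l).map fun j => looping n (a + j) ^ e j).prod

/-- The ascending word `σ_1^{e 0} σ_2^{e 1} ⋯ σ_l^{e (l-1)}` (empty for `l = 0`). -/
def ascWord (n l : ℕ) (e : ℕ → ℤ) : BraidB n :=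
  ((List.range l).map fun j => braidSigma n (j + 1) ^ e j).prod

/-- The descending word `σ_l^{e (l-1)} ⋯ σ_2^{e 1} σ_1^{e 0}` (empty for `l = 0`). -/
def descWord (n l : ℕ) (e : ℕ → ℤ) : BraidB n :=
  ((List.range l).reverse.map fun j => braidSigma n (j + 1) ^ e j).prod

/-- The coefficient ring `ℂ[q, q⁻¹]`; the power `q ^ a` is `LaurentPolynomial.T a`. -/
abbrev QRing : Type := LaurentPolynomial ℂ

/-- `q ^ a` in `ℂ[q, q⁻¹]`, for an integer `a`. -/
noncomputable def qPow (a : ℤ) : QRing := LaurentPolynomial.T a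

/-- The quadratic relations `σ_i² = (q - 1) σ_i + q`, `1 ≤ i ≤ n - 1`. -/
inductive HeckeRel (n : ℕ) :
    MonoidAlgebra QRing (BraidB n) → MonoidAlgebra QRing (BraidB n) → Prop
  | quadratic (i : ℕ) (h1 : 1 ≤ i) (h2 : i ≤ n - 1) :
      HeckeRel n
        (MonoidAlgebra.of QRing (BraidB n) (braidSigma n i) ^ 2)
        ((qPow 1 - 1) • MonoidAlgebra.of QRing (BraidB n) (braidSigma n i) + qPow 1 • 1)

/-- The generalized Iwahori-Hecke algebra of type B, `H_{1,n}(q)`: the quotient of the group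
algebra `ℂ[q, q⁻¹] B_{1,n}` by the quadratic relations. -/
abbrev HeckeB (n : ℕ) : Type := RingQuot (HeckeRel n)

/-- The canonical map `B_{1,n} → H_{1,n}(q)`. -/
noncomputable def toHecke (n : ℕ) : BraidB n →* HeckeB n :=
  ((RingQuot.mkAlgHom QRing (HeckeRel n) :
      MonoidAlgebra QRing (BraidB n) →ₐ[QRing] HeckeB n) :
    MonoidAlgebra QRing (BraidB n) →* HeckeB n).comp (MonoidAlgebra.of QRing (BraidB n))

/-- The linear span of the differences `β⁻¹ a β - a`, with `β` a braid. -/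
noncomputable def conjSpan (n : ℕ) : Submodule QRing (HeckeB n) :=
  Submodule.span QRing
    {x | ∃ (β : BraidB n) (a : HeckeB n), x = toHecke n β⁻¹ * a * toHecke n β - a}

/-- Equality up to conjugation in `H_{1,n}(q)`: the linear equivalence relation generated by
`a ∼ β⁻¹ a β` for braids `β`. -/
def ConjEq (n : ℕ) (x y : HeckeB n) : Prop := x - y ∈ conjSpan n

/-! The indices are lowered one factor at a time, from the left. Write s = σ_{i+1}^ε with ε = ±1.
Then t_{i+1}^ε = s t_i^ε s and s² = (q^ε - 1)s + q^ε, so expanding the k-th power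
(`pow_expand_of_quadratic`) gives a leading term s t_i^{εk} s and mixed terms s t_i^{εu}
t_{i+1}^{ε(k-u)}. The left s commutes with the lowered factors t_0, …, t_{i-1}, so conjugation
carries it to the end of the word, extending A_i to A_{i+1}. In the leading term the right s
commutes with t_{i+2}, t_{i+3}, … and extends D_i to D_{i+1} (`conjEq_lower_step`). Mixed terms are
final; only the leading term is processed further. The braid σ_1^δ plays no role and may be any g.
-/

theorem conjEq_iff_exists_add {n : ℕ} {x y : HeckeB n} :
    ConjEq n x y ↔ ∃ z ∈ conjSpan n, x = y + z := by
  constructor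
  · intro h
    exact ⟨x - y, h, (add_sub_cancel y x).symm⟩
  · rintro ⟨z, hz, rfl⟩
    have h : y + z - y = z := by exact add_sub_cancel_left y z
    rwa [ConjEq, h]

theorem ConjEq.refl {n : ℕ} (x : HeckeB n) : ConjEq n x x :=
  conjEq_iff_exists_add.mpr ⟨0, (conjSpan n).zero_mem, (add_zero x).symm⟩

theorem ConjEq.trans {n : ℕ} {x y z : HeckeB n} (h₁ : ConjEq n x y) (h₂ : ConjEq n y z) :
    ConjEq n x z := by
  rw [conjEq_iff_exists_add] at *
  obtain ⟨a, ha, rfl⟩ := h₁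
  obtain ⟨b, hb, rfl⟩ := h₂
  exact ⟨b + a, (conjSpan n).add_mem hb ha, add_assoc _ _ _⟩

theorem ConjEq.add {n : ℕ} {x y z w : HeckeB n} (h₁ : ConjEq n x y) (h₂ : ConjEq n z w) :
    ConjEq n (x + z) (y + w) := by
  rw [conjEq_iff_exists_add] at *
  obtain ⟨a, ha, rfl⟩ := h₁
  obtain ⟨b, hb, rfl⟩ := h₂
  exact ⟨a + b, (conjSpan n).add_mem ha hb, add_add_add_comm _ _ _ _⟩

theorem ConjEq.smul {n : ℕ} {x y : HeckeB n} (c : QRing) (h : ConjEq n x y) :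
    ConjEq n (c • x) (c • y) := by
  rw [conjEq_iff_exists_add] at *
  obtain ⟨a, ha, rfl⟩ := h
  exact ⟨c • a, (conjSpan n).smul_mem c ha, smul_add c _ _⟩

theorem ConjEq.sum {n : ℕ} {ι : Type*} (s : Finset ι) {f g : ι → HeckeB n}
    (h : ∀ i ∈ s, ConjEq n (f i) (g i)) : ConjEq n (∑ i ∈ s, f i) (∑ i ∈ s, g i) := by
  classical
  induction s using Finset.induction_on with
  | empty => exact ConjEq.refl _
  | insert a s ha ih =>
    rw [Finset.sum_insert ha, Finset.sum_insert ha]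
    exact (h a (Finset.mem_insert_self a s)).add
      (ih fun i hi => h i (Finset.mem_insert_of_mem hi))

/-- Cyclic rotation of a product of braids. -/
theorem conjEq_mul_comm {n : ℕ} (x y : BraidB n) :
    ConjEq n (toHecke n (x * y)) (toHecke n (y * x)) := by
  -- Conjugation by y: y⁻¹(yx)y = xy.
  refine Submodule.subset_span ⟨y, toHecke n (y * x), ?_⟩
  rw [← map_mul, ← map_mul]
  congr 2
  group

/-! ### Commutation of crossings with looping elements -/

theorem braidSigma_braid {n i : ℕ} (h1 : 1 ≤ i) (h2 : i + 1 ≤ n - 1) :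
    braidSigma n i * braidSigma n (i + 1) * braidSigma n i =
      braidSigma n (i + 1) * braidSigma n i * braidSigma n (i + 1) := by
  have hi : 1 ≤ i ∧ i ≤ n - 1 := by omega
  have hj : 1 ≤ i + 1 ∧ i + 1 ≤ n - 1 := by omega
  simp only [braidSigma, dif_pos hi, dif_pos hj]
  rw [← mul_inv_eq_one]
  exact PresentedGroup.one_of_mem
    (ArtinBRelator.braid (n := n) ⟨i - 1, by omega⟩ ⟨i + 1 - 1, by omega⟩ (by simp; omega))

/-- No range bounds are needed, since out-of-range crossings are 1. -/
theorem braidSigma_commute {n i j : ℕ} (hij : i + 1 < j) :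
    Commute (braidSigma n i) (braidSigma n j) := by
  by_cases hi : 1 ≤ i ∧ i ≤ n - 1
  · by_cases hj : 1 ≤ j ∧ j ≤ n - 1
    · simp only [braidSigma, dif_pos hi, dif_pos hj]
      rw [commute_iff_eq, ← mul_inv_eq_one]
      exact PresentedGroup.one_of_mem
        (ArtinBRelator.farComm (n := n) ⟨i - 1, by omega⟩ ⟨j - 1, by omega⟩ (by simp; omega))
    · simp [braidSigma, dif_neg hj]
  · simp [braidSigma, dif_neg hi]

theorem braidT_commute_braidSigma {n i : ℕ} (hi : 2 ≤ i) :
    Commute (braidT n) (braidSigma n i) := by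
  by_cases h : 1 ≤ i ∧ i ≤ n - 1
  · simp only [braidSigma, dif_pos h]
    rw [commute_iff_eq, ← mul_inv_eq_one]
    exact PresentedGroup.one_of_mem
      (ArtinBRelator.loopComm (n := n) ⟨i - 1, by omega⟩ (by simp; omega))
  · simp [braidSigma, dif_neg h]

theorem braidSigma_commute_looping_of_lt {n a j : ℕ} (h : j + 1 < a) :
    Commute (braidSigma n a) (looping n j) := by
  induction j with
  | zero => exact (braidT_commute_braidSigma (by omega)).symm
  | succ j ih =>
    have hs : Commute (braidSigma n a) (braidSigma n (j + 1)) :=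
      (braidSigma_commute (by omega)).symm
    exact (hs.mul_right (ih (by omega))).mul_right hs

/-- The braid relation turns σ_{a+1} into σ_{a+2} on the way in, σ_{a+2} slides past t_a, and the
braid relation turns it back on the way out. -/
theorem braidSigma_commute_looping_succ {n a : ℕ} (h : a + 2 ≤ n - 1) :
    Commute (braidSigma n (a + 1)) (looping n (a + 2)) := by
  have hb := braidSigma_braid (n := n) (i := a + 1) (by omega) (by omega)
  have hc : Commute (braidSigma n (a + 2)) (looping n a) :=
    braidSigma_commute_looping_of_lt (by omega)
  simp only [looping, commute_iff_eq]
  generalize looping n a = t at *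
  generalize braidSigma n (a + 1) = x at *
  generalize braidSigma n (a + 2) = y at *
  calc x * (y * (x * t * x) * y) = (x * y * x) * t * x * y := by group
    _ = y * x * (y * t) * x * y := by rw [hb]; group
    _ = y * x * t * (y * x * y) := by rw [hc.eq]; group
    _ = y * (x * t * x) * y * x := by rw [← hb]; group

theorem braidSigma_commute_looping_of_gt {n a j : ℕ} (ha : 1 ≤ a) (h : a < j)
    (hj : j ≤ n - 1) : Commute (braidSigma n a) (looping n j) := by
  induction j, h using Nat.le_induction with
  | base =>
    obtain ⟨a, rfl⟩ := Nat.exists_eq_add_of_le' ha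
    exact braidSigma_commute_looping_succ hj
  | succ j h ih =>
    have hs : Commute (braidSigma n a) (braidSigma n (j + 1)) := braidSigma_commute (by omega)
    exact (hs.mul_right (ih (by omega))).mul_right hs

theorem commute_loopMonomial {n a l : ℕ} {e : ℕ → ℤ} {x : BraidB n}
    (h : ∀ j < l, Commute x (looping n (a + j))) : Commute x (loopMonomial n a l e) := by
  refine Commute.list_prod_right _ _ fun y hy => ?_
  obtain ⟨j, hj, rfl⟩ := List.mem_map.mp hy
  exact (h j (List.mem_range.mp hj)).zpow_right _

theorem loopMonomial_zero_length (n a : ℕ) (e : ℕ → ℤ) : loopMonomial n a 0 e = 1 := by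
  simp [loopMonomial]

theorem loopMonomial_succ_last (n a l : ℕ) (e : ℕ → ℤ) :
    loopMonomial n a (l + 1) e = loopMonomial n a l e * looping n (a + l) ^ e l := by
  simp [loopMonomial, List.range_succ]

theorem loopMonomial_succ_first (n a l : ℕ) (e : ℕ → ℤ) :
    loopMonomial n a (l + 1) e =
      looping n a ^ e 0 * loopMonomial n (a + 1) l (fun j => e (j + 1)) := by
  simp [loopMonomial, List.range_succ_eq_map, Function.comp_def, add_assoc, add_comm 1]

theorem ascWord_succ (n l : ℕ) (e : ℕ → ℤ) :
    ascWord n (l + 1) e = ascWord n l e * braidSigma n (l + 1) ^ e l := by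
  simp [ascWord, List.range_succ]

theorem descWord_succ (n l : ℕ) (e : ℕ → ℤ) :
    descWord n (l + 1) e = braidSigma n (l + 1) ^ e l * descWord n l e := by
  simp [descWord, List.range_succ]

/-! ### Quadratic relation and powers of looping elements -/

theorem qPow_add (a b : ℤ) : qPow (a + b) = qPow a * qPow b :=
  LaurentPolynomial.T_add a b

theorem qPow_zero : qPow 0 = 1 := LaurentPolynomial.T_zero

theorem toHecke_braidSigma_sq {n i : ℕ} (h1 : 1 ≤ i) (h2 : i ≤ n - 1) :
    toHecke n (braidSigma n i) * toHecke n (braidSigma n i) =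
      (qPow 1 - 1) • toHecke n (braidSigma n i) + qPow 1 • 1 := by
  have h := RingQuot.mkAlgHom_rel QRing (HeckeRel.quadratic (n := n) i h1 h2)
  rw [map_pow, map_add, map_smul, map_smul, map_one, sq] at h
  exact h

theorem toHecke_braidSigma_zpow_sq {n i : ℕ} (h1 : 1 ≤ i) (h2 : i ≤ n - 1) {ε : ℤ}
    (hε : ε = 1 ∨ ε = -1) :
    toHecke n (braidSigma n i ^ ε) * toHecke n (braidSigma n i ^ ε) =
      (qPow ε - 1) • toHecke n (braidSigma n i ^ ε) + qPow ε • 1 := by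
  have hs := toHecke_braidSigma_sq h1 h2
  rcases hε with rfl | rfl
  · simpa using hs
  · have hq : qPow (-1) * qPow 1 = 1 := by rw [← qPow_add]; exact qPow_zero
    rw [zpow_neg_one]
    set s := toHecke n (braidSigma n i)
    set r := toHecke n (braidSigma n i)⁻¹
    have hrs : r * s = 1 := by simp [r, s, ← map_mul]
    -- Multiplying s² = (q - 1)s + q by q⁻¹s⁻² gives the same relation for s⁻¹, with q⁻¹ in place of
    -- q.
    have h := congrArg (fun x => qPow (-1) • (r * r * x)) hs
    have h₁ : r * r * (s * s) = 1 := by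
      rw [mul_assoc, ← mul_assoc r s s, hrs, one_mul, hrs]
    have h₂ : r * r * s = r := by rw [mul_assoc, hrs, mul_one]
    simp only [mul_add, mul_smul_comm, mul_one, h₁, h₂, smul_add, smul_smul, hq, one_smul] at h
    have h₃ : qPow (-1) * (qPow 1 - 1) = 1 - qPow (-1) := by rw [mul_sub, hq, mul_one]
    rw [h₃] at h
    rw [h, ← add_assoc, ← add_smul]
    simp

/-- Expansion of `(s a s)ᵏ` for an element `s` satisfying a quadratic relation. -/
theorem pow_expand_of_quadratic {R A : Type*} [CommSemiring R] [Semiring A] [Algebra R A] {p Q : R}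
    {s a b : A} (hs : s * s = p • s + Q • (1 : A)) (hb : b = s * a * s) (k : ℕ) :
    b ^ (k + 1) = Q ^ k • (s * a ^ (k + 1) * s) +
      ∑ u ∈ Finset.range k, (Q ^ u * p) • (s * a ^ (u + 1) * b ^ (k - u)) := by
  induction k with
  | zero => simp [hb]
  | succ k ih =>
    -- Only the leading term meets s·s when multiplied by b; its p-part is the new summand u = k.
    have key : s * a ^ (k + 1) * s * b =
        p • (s * a ^ (k + 1) * b) + Q • (s * a ^ (k + 1 + 1) * s) := by
      calc s * a ^ (k + 1) * s * b = s * a ^ (k + 1) * (s * s) * a * s := by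
            simp only [hb, mul_assoc]
        _ = p • (s * a ^ (k + 1) * (s * a * s)) + Q • (s * (a ^ (k + 1) * a) * s) := by
            rw [hs]
            simp only [mul_add, add_mul, mul_smul_comm, smul_mul_assoc, mul_one, mul_assoc]
        _ = _ := by rw [← hb, ← pow_succ]
    rw [pow_succ b, ih, add_mul, smul_mul_assoc, key, smul_add, smul_smul, smul_smul,
      Finset.sum_range_succ, Finset.sum_mul, ← pow_succ]
    have hsum : ∀ u ∈ Finset.range k,
        (Q ^ u * p) • (s * a ^ (u + 1) * b ^ (k - u)) * b =
          (Q ^ u * p) • (s * a ^ (u + 1) * b ^ (k + 1 - u)) := by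
      intro u hu
      rw [smul_mul_assoc, mul_assoc _ _ b, ← pow_succ,
        Nat.succ_sub (Finset.mem_range.mp hu).le]
    rw [Finset.sum_congr rfl hsum]
    simp only [Nat.add_sub_cancel_left, pow_one]
    abel

theorem qPow_mul_natCast (a : ℤ) (u : ℕ) : qPow (a * u) = qPow a ^ u := by
  rw [mul_comm]; exact (LaurentPolynomial.T_pow a u).symm

/-- The word s t_i s is symmetric, so its inverse has the same shape; both signs can then be treated
together. -/
theorem looping_succ_zpow {n i : ℕ} {ε : ℤ} (hε : ε = 1 ∨ ε = -1) :
    looping n (i + 1) ^ ε =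
      braidSigma n (i + 1) ^ ε * looping n i ^ ε * braidSigma n (i + 1) ^ ε := by
  rcases hε with rfl | rfl <;> simp [looping, mul_assoc]

theorem toHecke_looping_succ_zpow_succ {n i : ℕ} (k : ℕ) (hi : i + 1 ≤ n - 1) {ε : ℤ}
    (hε : ε = 1 ∨ ε = -1) :
    toHecke n (looping n (i + 1) ^ (ε * ((k + 1 : ℕ) : ℤ))) =
      qPow ε ^ k •
          (toHecke n (braidSigma n (i + 1) ^ ε) * toHecke n (looping n i ^ ε) ^ (k + 1) *
            toHecke n (braidSigma n (i + 1) ^ ε)) +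
        ∑ u ∈ Finset.range k, (qPow ε ^ u * (qPow ε - 1)) •
          (toHecke n (braidSigma n (i + 1) ^ ε) * toHecke n (looping n i ^ ε) ^ (u + 1) *
            toHecke n (looping n (i + 1) ^ ε) ^ (k - u)) := by
  have hb := congrArg (toHecke n) (looping_succ_zpow (n := n) (i := i) hε)
  rw [map_mul, map_mul] at hb
  have h := pow_expand_of_quadratic
    (toHecke_braidSigma_zpow_sq (n := n) (i := i + 1) (by omega) hi hε) hb k
  rw [zpow_mul, zpow_natCast, map_pow]
  exact h

/-- Lowering the index of a power of a looping element. -/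
theorem toHecke_looping_succ_zpow {n i k : ℕ} (hi : i + 1 ≤ n - 1) (hk : 1 ≤ k) {ε : ℤ}
    (hε : ε = 1 ∨ ε = -1) :
    toHecke n (looping n (i + 1) ^ (ε * (k : ℤ))) =
      qPow (ε * ((k : ℤ) - 1)) •
          toHecke n (braidSigma n (i + 1) ^ ε * looping n i ^ (ε * (k : ℤ)) *
            braidSigma n (i + 1) ^ ε) +
        ∑ u ∈ Finset.Icc 1 (k - 1), (qPow (ε * ((u : ℤ) - 1)) * (qPow ε - 1)) •
          toHecke n (braidSigma n (i + 1) ^ ε * looping n i ^ (ε * (u : ℤ)) *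
            looping n (i + 1) ^ (ε * ((k : ℤ) - (u : ℤ)))) := by
  obtain ⟨k, rfl⟩ := Nat.exists_eq_add_of_le' hk
  rw [toHecke_looping_succ_zpow_succ k hi hε]
  refine congrArg₂ (· + ·) ?_ ?_
  · rw [Nat.cast_succ, add_sub_cancel_right, qPow_mul_natCast, zpow_mul, ← Nat.cast_succ,
      zpow_natCast]
    simp only [map_mul, map_pow]
  · rw [Nat.add_sub_cancel, ← Finset.Ico_succ_right_eq_Icc, Finset.sum_Ico_eq_sum_range]
    refine Finset.sum_congr (by simp) fun u hu => ?_
    have hu : u ≤ k := by simp at hu; omega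
    have h₁ : ((1 + u : ℕ) : ℤ) - 1 = u := by push_cast; ring
    have h₂ : ((k + 1 : ℕ) : ℤ) - ((1 + u : ℕ) : ℤ) = ((k - u : ℕ) : ℤ) := by
      push_cast [hu]; ring
    rw [h₁, h₂, qPow_mul_natCast, zpow_mul, zpow_mul, zpow_natCast, zpow_natCast, add_comm 1 u]
    simp only [map_mul, map_pow]

/-! ### Lowering indices up to conjugation -/

/-- One step of the index lowering, inside a word whose left and right looping monomials commute
with the crossing involved. -/
theorem conjEq_lower_step {n i k : ℕ} (hi : i + 1 ≤ n - 1) (hk : 1 ≤ k) {ε : ℤ}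
    (hε : ε = 1 ∨ ε = -1) {P R W A : BraidB n} (hP : Commute (braidSigma n (i + 1)) P)
    (hR : Commute (braidSigma n (i + 1)) R) :
    ConjEq n
      (toHecke n (P * looping n (i + 1) ^ (ε * (k : ℤ)) * R * (W * A)))
      (qPow (ε * ((k : ℤ) - 1)) •
          toHecke n (P * looping n i ^ (ε * (k : ℤ)) * R *
            (braidSigma n (i + 1) ^ ε * W * (A * braidSigma n (i + 1) ^ ε))) +
        ∑ u ∈ Finset.Icc 1 (k - 1), (qPow (ε * ((u : ℤ) - 1)) * (qPow ε - 1)) •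
          toHecke n (P * looping n i ^ (ε * (u : ℤ)) *
            looping n (i + 1) ^ (ε * ((k : ℤ) - (u : ℤ))) * R *
              (W * (A * braidSigma n (i + 1) ^ ε)))) := by
  have hP' : Commute (braidSigma n (i + 1) ^ ε) P := hP.zpow_left ε
  have hR' : Commute (braidSigma n (i + 1) ^ ε) R := hR.zpow_left ε
  have move : ∀ X : BraidB n,
      ConjEq n (toHecke n (P * (braidSigma n (i + 1) ^ ε * X) * (W * A)))
        (toHecke n (P * X * (W * (A * braidSigma n (i + 1) ^ ε)))) := by
    intro X
    have h := conjEq_mul_comm (braidSigma n (i + 1) ^ ε) (P * X * (W * A))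
    have h₁ : P * (braidSigma n (i + 1) ^ ε * X) * (W * A) =
        braidSigma n (i + 1) ^ ε * (P * X * (W * A)) := by
      simp only [← mul_assoc, hP'.eq]
    rw [h₁]
    simpa only [mul_assoc] using h
  rw [mul_assoc, mul_assoc P, map_mul, map_mul, toHecke_looping_succ_zpow hi hk hε]
  simp only [mul_add, add_mul, Finset.mul_sum, Finset.sum_mul, mul_smul_comm, smul_mul_assoc,
    ← map_mul]
  refine ConjEq.add (ConjEq.smul _ ?_) (ConjEq.sum _ fun u _ => ConjEq.smul _ ?_)
  -- The second crossing of the leading term passes R and is absorbed on the left of W.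
  · have h := move (looping n i ^ (ε * (k : ℤ)) * R * braidSigma n (i + 1) ^ ε)
    rw [mul_assoc _ R, ← hR'.eq] at h
    convert h using 2
    · simp only [mul_assoc]
    · rw [hR'.eq]
      simp only [mul_assoc]
  · simpa only [mul_assoc] using move (looping n i ^ (ε * (u : ℤ)) *
      looping n (i + 1) ^ (ε * ((k : ℤ) - (u : ℤ))) * R)

/-- The first `r` looping factors have been lowered. -/
theorem conjEq_lower_first (n m : ℕ) (hn : m + 2 ≤ n) (k : ℕ → ℕ) (hk : ∀ i ≤ m, 1 ≤ k i)
    (ε : ℕ → ℤ) (hε : ∀ i ≤ m, ε i = 1 ∨ ε i = -1) (g : BraidB n) (r : ℕ) (hr : r ≤ m + 1) :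
    ConjEq n
      (toHecke n (loopMonomial n 1 (m + 1) (fun i => ε i * (k i : ℤ)) * g))
      (qPow (∑ i ∈ Finset.range r, ε i * ((k i : ℤ) - 1)) •
          toHecke n
            (loopMonomial n 0 r (fun i => ε i * (k i : ℤ)) *
              loopMonomial n (r + 1) (m + 1 - r) (fun j => ε (r + j) * (k (r + j) : ℤ)) *
              (descWord n r ε * g * ascWord n r ε)) +
        ∑ i ∈ Finset.range r, ∑ u ∈ Finset.Icc 1 (k i - 1),
          (qPow (∑ j ∈ Finset.range i, ε j * ((k j : ℤ) - 1) + ε i * ((u : ℤ) - 1)) *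
              (qPow (ε i) - 1)) •
            toHecke n
              (loopMonomial n 0 i (fun j => ε j * (k j : ℤ)) *
                looping n i ^ (ε i * (u : ℤ)) *
                looping n (i + 1) ^ (ε i * ((k i : ℤ) - (u : ℤ))) *
                loopMonomial n (i + 2) (m - i)
                  (fun j => ε (i + 1 + j) * (k (i + 1 + j) : ℤ)) *
                (descWord n i ε * g * ascWord n (i + 1) ε))) := by
  induction r with
  | zero =>
    simpa [qPow_zero, loopMonomial_zero_length, ascWord, descWord] using ConjEq.refl _
  | succ r ih =>
    refine (ih (by omega)).trans ?_
    have hR : loopMonomial n (r + 1) (m + 1 - r) (fun j => ε (r + j) * (k (r + j) : ℤ)) =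
        looping n (r + 1) ^ (ε r * (k r : ℤ)) *
          loopMonomial n (r + 2) (m - r) (fun j => ε (r + 1 + j) * (k (r + 1 + j) : ℤ)) := by
      rw [show m + 1 - r = m - r + 1 by omega, loopMonomial_succ_first]
      simp only [add_zero, add_assoc, add_comm 1]
    have step := conjEq_lower_step (n := n) (i := r) (k := k r) (by omega) (hk r (by omega))
      (hε r (by omega)) (P := loopMonomial n 0 r (fun i => ε i * (k i : ℤ)))
      (R := loopMonomial n (r + 2) (m - r) (fun j => ε (r + 1 + j) * (k (r + 1 + j) : ℤ)))
      (W := descWord n r ε * g) (A := ascWord n r ε)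
      -- σ_{r+1} commutes with t_j for j < r and for r + 2 ≤ j ≤ m + 1 ≤ n - 1.
      (commute_loopMonomial fun j hj => braidSigma_commute_looping_of_lt (by omega))
      (commute_loopMonomial fun j hj =>
        braidSigma_commute_looping_of_gt (by omega) (by omega) (by omega))
    have h := ((step.smul (qPow (∑ i ∈ Finset.range r, ε i * ((k i : ℤ) - 1)))).add
      (ConjEq.refl (∑ i ∈ Finset.range r, ∑ u ∈ Finset.Icc 1 (k i - 1),
          (qPow (∑ j ∈ Finset.range i, ε j * ((k j : ℤ) - 1) + ε i * ((u : ℤ) - 1)) *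
              (qPow (ε i) - 1)) •
            toHecke n
              (loopMonomial n 0 i (fun j => ε j * (k j : ℤ)) *
                looping n i ^ (ε i * (u : ℤ)) *
                looping n (i + 1) ^ (ε i * ((k i : ℤ) - (u : ℤ))) *
                loopMonomial n (i + 2) (m - i)
                  (fun j => ε (i + 1 + j) * (k (i + 1 + j) : ℤ)) *
                (descWord n i ε * g * ascWord n (i + 1) ε)))))
    rw [hR, ← mul_assoc (loopMonomial n 0 r _)]
    convert h using 1
    -- The mixed terms of this step form the summand i = r, weighted by the accumulated power of q.
    rw [Finset.sum_range_succ, Finset.sum_range_succ, smul_add, smul_smul, ← qPow_add,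
      Finset.smul_sum, loopMonomial_succ_last, descWord_succ, ascWord_succ, zero_add,
      Nat.succ_sub_succ]
    simp only [smul_smul, qPow_add, mul_assoc]
    rw [← add_assoc, add_right_comm]

theorem mainTheorem8 (n m : ℕ) (hn : m + 2 ≤ n) (k : ℕ → ℕ) (hk : ∀ i ≤ m, 1 ≤ k i)
    (ε : ℕ → ℤ) (hε : ∀ i ≤ m, ε i = 1 ∨ ε i = -1) (δ : ℤ) (hδ : δ = 1 ∨ δ = -1) :
    ConjEq n
      (toHecke n (loopMonomial n 1 (m + 1) (fun i => ε i * (k i : ℤ)) * braidSigma n 1 ^ δ))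
      (qPow (∑ i ∈ Finset.range (m + 1), ε i * ((k i : ℤ) - 1)) •
          toHecke n
            (loopMonomial n 0 (m + 1) (fun i => ε i * (k i : ℤ)) *
              (descWord n (m + 1) ε * braidSigma n 1 ^ δ * ascWord n (m + 1) ε)) +
        ∑ i ∈ Finset.range (m + 1), ∑ u ∈ Finset.Icc 1 (k i - 1),
          (qPow (∑ j ∈ Finset.range i, ε j * ((k j : ℤ) - 1) + ε i * ((u : ℤ) - 1)) *
              (qPow (ε i) - 1)) •
            toHecke n
              (loopMonomial n 0 i (fun j => ε j * (k j : ℤ)) *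
                looping n i ^ (ε i * (u : ℤ)) *
                looping n (i + 1) ^ (ε i * ((k i : ℤ) - (u : ℤ))) *
                loopMonomial n (i + 2) (m - i)
                  (fun j => ε (i + 1 + j) * (k (i + 1 + j) : ℤ)) *
                (descWord n i ε * braidSigma n 1 ^ δ * ascWord n (i + 1) ε))) := by
  have h := conjEq_lower_first n m hn k hk ε hε (braidSigma n 1 ^ δ) (m + 1) le_rfl
  rwa [Nat.sub_self, loopMonomial_zero_length, mul_one] at h
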